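/- For positive integers $n,k$ put $H_n=\sum_{j=1}^n \frac1j$, $\zeta_n(k)=\sum_{j=1}^n\frac1{j^k}$ and $L_n(k)=\sum_{j=1}^n\frac{(-1)^{j-1}}{j^k}$. Let $\zeta(s)=\sum_{n\ge1}\frac1{n^s}$ for integers $s\ge2$, and $\bar\zeta(s)=\sum_{n\ge1}\frac{(-1)^{n-1}}{n^s}$ for integers $s\ge1$ (so the series is conditionally convergent for $s=1$). For integers $q\ge2$ and $r\ge1$ let \[ \zeta^\star(\bar q,r)=\sum_{m\ge1}\frac{(-1)^m}{m^q}\sum_{k=1}^m\frac1{k^r},\qquad \zeta^\star(q,\bar r)=\sum_{m\ge1}\frac1{m^q}\sum_{k=1}^m\frac{(-1)^k}{k^r},\qquad \zeta^\star(\bar q,\bar r)=\sum_{m\ge1}\frac{(-1)^m}{m^q}\sum_{k=1}^m\frac{(-1)^k}{k^r}, \] and let $\zeta^\star(q,r)$ be the same double series without signs. For every integer $p\ge1$ the two series on the left-hand side below converge absolutely, as do the series for $\zeta^\star$ with $q\ge2$, $r\ge1$; the series for $\bar\zeta(s)$, $s\ge1$, converges; and \begin{align*} &\frac32\sum_{n=1}^\infty\frac{L_n(1)^2}{n^{p+1}}(-1)^{n-1}-\bigl(1+(-1)^{p-1}\bigr)\sum_{n=1}^\infty\frac{H_n^2}{n^{p+1}}(-1)^{n-1}\\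 &=\ln2\,\bigl(\zeta^\star(\overline{p+1},\bar1)-\zeta^\star(\overline{p+1},1)\bigr)+\tfrac12\zeta(2)\bigl\{\zeta(p+1)+\bar\zeta(p+1)\bigr\}+\tfrac12\zeta^\star(\overline{p+1},2)\\ &\quad-\sum_{j=2}^{p}\bigl(1-(-1)^{j-1}\bigr)\zeta^\star(\bar j,1)\,\zeta(p+2-j)-\sum_{j=2}^{p+1}\zeta^\star(j,\bar1)\,\bar\zeta(p+2-j)\\ &\quad+\bigl(p+2+(-1)^{p-1}\bigr)\zeta^\star(\overline{p+2},1)-\zeta^\star(p+2,\bar1)-\sum_{i=1}^{p-1}(-1)^{i-1}\zeta(p+1-i)\,\bar\zeta(i+2)\\ &\quad-(p+1)\,\zeta^\star(\overline{p+2},\bar1)+\ln2\;\zeta^\star(\overline{p+1},\bar1), \end{align*} where empty sums are $0$. -/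

import Mathlib

namespace EulerSum

noncomputable section

/-- The generalized harmonic number `ζ_n(k) = ∑_{j=1}^n 1 / j ^ k`. -/
def zetaN (k n : ℕ) : ℝ := ∑ j ∈ Finset.Icc 1 n, 1 / (j : ℝ) ^ k

/-- The harmonic number `H_n = ∑_{j=1}^n 1 / j`. -/
def H (n : ℕ) : ℝ := zetaN 1 n

/-- The alternating harmonic number `L_n(k) = ∑_{j=1}^n (-1)^(j-1) / j ^ k`. -/
def L (k n : ℕ) : ℝ := ∑ j ∈ Finset.Icc 1 n, (-1 : ℝ) ^ (j - 1) / (j : ℝ) ^ k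

/-- The zeta value `ζ(s) = ∑_{n ≥ 1} 1 / n ^ s` at an integer `s ≥ 2`
(the index is shifted: the `n`-th term of the Lean series is the term at `n + 1`). -/
def zeta (s : ℕ) : ℝ := ∑' n : ℕ, 1 / ((n : ℝ) + 1) ^ s

/-- The terms of the alternating zeta series: the `n`-th one is `(-1)^n / (n+1)^s`. -/
def zetaBarTerm (s n : ℕ) : ℝ := (-1 : ℝ) ^ n / ((n : ℝ) + 1) ^ s

/-- The alternating zeta value `∑_{n ≥ 1} (-1)^(n-1) / n ^ s` at an integer `s ≥ 1`. The series is
summed in its natural order, as a limit of partial sums, since it converges only conditionally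
at `s = 1`. -/
def zetaBar (s : ℕ) : ℝ := ∑'[SummationFilter.conditional ℕ] n, zetaBarTerm s n

/-- The terms of the double zeta-star series with signs `ε₁`, `ε₂`: the `n`-th one is
`ε₁ ^ m / m ^ q * ∑_{k=1}^m ε₂ ^ k / k ^ r` at `m = n + 1`. -/
def zetaStarTerm (ε₁ ε₂ : ℝ) (q r n : ℕ) : ℝ :=
  ε₁ ^ (n + 1) / ((n : ℝ) + 1) ^ q * ∑ k ∈ Finset.Icc 1 (n + 1), ε₂ ^ k / (k : ℝ) ^ r

/-- The double zeta-star value `∑_{m ≥ k ≥ 1} ε₁ ^ m ε₂ ^ k / (m ^ q k ^ r)`, for `q ≥ 2`, `r ≥ 1`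
and signs `ε₁`, `ε₂` in `{1, -1}`: a sign `-1` is a bar over the corresponding argument, so that
`zetaStar (-1) 1 q r` is `ζ⋆(q̄, r)` and `zetaStar 1 (-1) q r` is `ζ⋆(q, r̄)`. -/
def zetaStar (ε₁ ε₂ : ℝ) (q r : ℕ) : ℝ := ∑' n : ℕ, zetaStarTerm ε₁ ε₂ q r n

/-- The terms of `∑_{n ≥ 1} H_n ^ 2 (-1)^(n-1) / n ^ q`, shifted to start at `n = 0`. -/
def altHSqTerm (q n : ℕ) : ℝ := H (n + 1) ^ 2 / ((n : ℝ) + 1) ^ q * (-1) ^ n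

/-- The terms of `∑_{n ≥ 1} L_n(1) ^ 2 (-1)^(n-1) / n ^ q`, shifted to start at `n = 0`. -/
def altLSqTerm (q n : ℕ) : ℝ := L 1 (n + 1) ^ 2 / ((n : ℝ) + 1) ^ q * (-1) ^ n

/-- `zeta` agrees with Mathlib's Riemann zeta function at the integers `s ≥ 2`. -/
theorem riemannZeta_eq_zeta {s : ℕ} (hs : 2 ≤ s) : riemannZeta (s : ℂ) = (zeta s : ℂ) := by
  rw [zeta_eq_tsum_one_div_nat_add_one_cpow (by simp; omega), zeta, Complex.ofReal_tsum]
  simp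

end

end EulerSum

/-!
The theorem is the sum of three relations. In each, a sum over `j` of products of two series is a
double series over `a` and `b` whose kernel `∑ j, 1 / (a ^ j y ^ (p + 2 - j))`, with `y = b` or
`y = -b`, is a geometric sum, equal to `1 / (a (a - y)) / y ^ p - 1 / (y (a - y)) / a ^ p` off the
diagonal. Summing first over `a` leaves a discrete Hilbert transform, at `±b`, of the numerators;
shifting the summation index turns the recurrence of the numerators into one in `b` for that
transform, which evaluates it in terms of partial sums of zeta series. For the numerators
`(-1) ^ a H_a` only the difference of the transforms at `b` and `-b` is evaluated. In the sum of
the three relations the terms foreign to the theorem cancel.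
-/

namespace EulerSum

open Filter Topology Asymptotics
open Finset (range Icc)

theorem zetaN_zero (k : ℕ) : zetaN k 0 = 0 := by simp [zetaN]

theorem zetaN_succ (k n : ℕ) : zetaN k (n + 1) = zetaN k n + 1 / ((n : ℝ) + 1) ^ k := by
  simp [zetaN, Finset.sum_Icc_succ_top]

theorem L_zero (k : ℕ) : L k 0 = 0 := by simp [L]

theorem L_succ (k n : ℕ) : L k (n + 1) = L k n + (-1) ^ n / ((n : ℝ) + 1) ^ k := by
  simp [L, Finset.sum_Icc_succ_top]

theorem H_zero : H 0 = 0 := zetaN_zero 1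

theorem H_succ (n : ℕ) : H (n + 1) = H n + 1 / ((n : ℝ) + 1) := by
  simp [H, zetaN_succ]

theorem H_eq_harmonic (n : ℕ) : H n = (harmonic n : ℝ) := by
  simp [H, zetaN, harmonic_eq_sum_Icc]

theorem H_nonneg (n : ℕ) : 0 ≤ H n :=
  Finset.sum_nonneg (s := Icc 1 n) fun _ _ => by positivity

theorem L_one_two_mul (n : ℕ) : L 1 (2 * n) = H (2 * n) - H n := by
  induction n with
  | zero => simp [L_zero, H_zero]
  | succ n ih =>
    have hsign : (-1 : ℝ) ^ (2 * n) = 1 := (even_two_mul n).neg_one_pow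
    rw [show 2 * (n + 1) = 2 * n + 1 + 1 by ring, L_succ, L_succ, H_succ, H_succ, H_succ, ih,
      pow_succ (-1 : ℝ), hsign]
    push_cast
    field_simp
    ring

theorem exists_tendsto_L {k : ℕ} (hk : 1 ≤ k) : ∃ l, Tendsto (L k) atTop (𝓝 l) := by
  have hanti : Antitone fun n : ℕ => 1 / ((n : ℝ) + 1) ^ k := fun a b hab => by
    dsimp only
    gcongr
  have hzero : Tendsto (fun n : ℕ => 1 / ((n : ℝ) + 1) ^ k) atTop (𝓝 0) := by
    simpa [show k ≠ 0 by omega] using tendsto_one_div_add_atTop_nhds_zero_nat (𝕜 := ℝ).pow k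
  obtain ⟨l, hl⟩ := hanti.tendsto_alternating_series_of_tendsto_zero hzero
  refine ⟨l, hl.congr fun n => ?_⟩
  induction n with
  | zero => simp [L_zero]
  | succ n ih => rw [Finset.sum_range_succ, ih, L_succ, mul_one_div]

theorem tendsto_L_one : Tendsto (L 1) atTop (𝓝 (Real.log 2)) := by
  have hdouble : Tendsto (fun n : ℕ => 2 * n) atTop atTop :=
    tendsto_id.const_mul_atTop' (by norm_num)
  have hγ := Real.tendsto_harmonic_sub_log
  have heven : Tendsto (fun n => L 1 (2 * n)) atTop (𝓝 (Real.log 2)) := by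
    have hlim := ((hγ.comp hdouble).sub hγ).add_const (Real.log 2)
    rw [sub_self, zero_add] at hlim
    refine hlim.congr' ?_
    filter_upwards [eventually_ne_atTop 0] with n hn
    rw [Function.comp_apply, L_one_two_mul, H_eq_harmonic, H_eq_harmonic, Nat.cast_mul,
      Nat.cast_ofNat, Real.log_mul two_ne_zero (Nat.cast_ne_zero.2 hn)]
    ring
  obtain ⟨l, hl⟩ := exists_tendsto_L le_rfl
  rwa [tendsto_nhds_unique (hl.comp hdouble) heven] at hl

/-- The partial sums `∑_{k=1}^n ε ^ k / k ^ r`, which for `ε = 1` and `ε = -1` are `ζ_n(r)` and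
`-L_n(r)`. -/
noncomputable def signedSum (ε : ℝ) (r n : ℕ) : ℝ := ∑ k ∈ Icc 1 n, ε ^ k / (k : ℝ) ^ r

theorem signedSum_zero (ε : ℝ) (r : ℕ) : signedSum ε r 0 = 0 := by simp [signedSum]

theorem signedSum_succ (ε : ℝ) (r n : ℕ) :
    signedSum ε r (n + 1) = signedSum ε r n + ε ^ (n + 1) / ((n : ℝ) + 1) ^ r := by
  simp [signedSum, Finset.sum_Icc_succ_top]

theorem signedSum_one (r n : ℕ) : signedSum 1 r n = zetaN r n := by simp [signedSum, zetaN]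

theorem signedSum_neg_one (r n : ℕ) : signedSum (-1) r n = -L r n := by
  induction n with
  | zero => simp [signedSum_zero, L_zero]
  | succ n ih =>
    rw [signedSum_succ, ih, L_succ, pow_succ]
    ring

theorem abs_signedSum_le_H {ε : ℝ} (hε : |ε| ≤ 1) {r : ℕ} (hr : 1 ≤ r) (n : ℕ) :
    |signedSum ε r n| ≤ H n := by
  refine (Finset.abs_sum_le_sum_abs _ _).trans (Finset.sum_le_sum fun k hk => ?_)
  have hk1 : (1 : ℝ) ≤ k := by exact_mod_cast (Finset.mem_Icc.1 hk).1
  rw [abs_div, abs_pow, abs_pow, Nat.abs_cast]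
  exact div_le_div₀ zero_le_one (pow_le_one₀ (abs_nonneg ε) hε) (by positivity)
    (pow_le_pow_right₀ hk1 hr)

/-- Real sequences growing more slowly than every positive power of `n`. -/
def Subpolynomial (c : ℕ → ℝ) : Prop :=
  ∀ θ : ℝ, 0 < θ → c =O[atTop] fun n : ℕ => (n : ℝ) ^ θ

namespace Subpolynomial

variable {c d : ℕ → ℝ}

theorem mono (hd : Subpolynomial d) (h : ∀ n, |c n| ≤ |d n|) : Subpolynomial c := fun θ hθ =>
  (isBigO_of_le _ h).trans (hd θ hθ)

theorem mul (hc : Subpolynomial c) (hd : Subpolynomial d) :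
    Subpolynomial fun n => c n * d n := fun θ hθ =>
  ((hc _ (half_pos hθ)).mul (hd _ (half_pos hθ))).congr_right fun n => by
    rw [← Real.rpow_add_of_nonneg n.cast_nonneg (half_pos hθ).le (half_pos hθ).le, add_halves]

theorem of_abs_le_one (h : ∀ n, |c n| ≤ 1) : Subpolynomial c := fun θ hθ => by
  refine IsBigO.of_bound' ?_
  filter_upwards [eventually_ge_atTop 1] with n hn
  have hpow : 1 ≤ (n : ℝ) ^ θ := Real.one_le_rpow (by exact_mod_cast hn) hθ.le
  exact (h n).trans (hpow.trans (le_abs_self _))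

theorem exists_abs_le (hc : Subpolynomial c) {θ : ℝ} (hθ : 0 < θ) :
    ∃ C, 0 ≤ C ∧ ∀ n ≠ 0, |c n| ≤ C * (n : ℝ) ^ θ := by
  obtain ⟨C, hC, hbound⟩ := bound_of_isBigO_nat_atTop (hc θ hθ)
  refine ⟨C, hC.le, fun n hn => ?_⟩
  have hpos : 0 < (n : ℝ) ^ θ := by positivity
  simpa only [Real.norm_eq_abs, abs_of_pos hpos] using hbound hpos.ne'

theorem isLittleO_natCast (hc : Subpolynomial c) : c =o[atTop] fun n : ℕ => (n : ℝ) := by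
  have hone : (fun _ => 1 : ℕ → ℝ) =o[atTop] fun n : ℕ => (n : ℝ) ^ (1 / 2 : ℝ) :=
    (isLittleO_one_left_iff ℝ).2 <| tendsto_norm_atTop_atTop.comp <|
      (tendsto_rpow_atTop one_half_pos).comp tendsto_natCast_atTop_atTop
  refine ((hc (1 / 2) one_half_pos).mul_isLittleO hone).congr (fun n => mul_one _) fun n => ?_
  rw [← Real.rpow_add_of_nonneg n.cast_nonneg (by norm_num) (by norm_num), add_halves,
    Real.rpow_one]

theorem tendsto_mul_inv_add (hc : Subpolynomial c) (y : ℝ) :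
    Tendsto (fun n => c n * ((n : ℝ) + y)⁻¹) atTop (𝓝 0) := by
  have hconst : (fun _ => y : ℕ → ℝ) =o[atTop] fun n : ℕ => (n : ℝ) :=
    isLittleO_const_left.2 <| .inr <| tendsto_norm_atTop_atTop.comp tendsto_natCast_atTop_atTop
  have hequiv : (fun n : ℕ => (n : ℝ) + y) ~[atTop] fun n : ℕ => (n : ℝ) :=
    IsEquivalent.refl.add_isLittleO hconst
  simpa only [div_eq_mul_inv] using
    (hc.isLittleO_natCast.trans_isBigO hequiv.isBigO_symm).tendsto_div_nhds_zero

theorem summable_div_pow (hc : Subpolynomial c) {q : ℕ} (hq : 2 ≤ q) :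
    Summable fun n : ℕ => c n / (n : ℝ) ^ q := by
  have hq' : (2 : ℝ) ≤ q := by exact_mod_cast hq
  refine summable_of_isBigO_nat (Real.summable_nat_rpow.2 (by linarith : 1 / 2 - (q : ℝ) < -1)) ?_
  refine ((hc (1 / 2) one_half_pos).mul (isBigO_refl (fun n : ℕ => ((n : ℝ) ^ q)⁻¹) _)).congr'
    (.of_forall fun n => (div_eq_mul_inv _ _).symm) ?_
  filter_upwards [eventually_gt_atTop 0] with n hn
  rw [Real.rpow_sub (Nat.cast_pos.2 hn), Real.rpow_natCast, ← div_eq_mul_inv]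

end Subpolynomial

theorem subpolynomial_H : Subpolynomial H := fun θ hθ => by
  have hone : (fun _ => 1 : ℝ → ℝ) =o[atTop] fun x : ℝ => x ^ θ :=
    (isLittleO_one_left_iff ℝ).2 <| tendsto_norm_atTop_atTop.comp (tendsto_rpow_atTop hθ)
  have hlog : (fun x : ℝ => 1 + Real.log x) =o[atTop] fun x : ℝ => x ^ θ :=
    hone.add (isLittleO_log_rpow_atTop hθ)
  refine .trans (.of_norm_le fun n => ?_) (hlog.isBigO.comp_tendsto tendsto_natCast_atTop_atTop)
  rw [Real.norm_of_nonneg (H_nonneg n), H_eq_harmonic]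
  exact harmonic_le_one_add_log n

theorem subpolynomial_signedSum {ε : ℝ} (hε : |ε| ≤ 1) {r : ℕ} (hr : 1 ≤ r) :
    Subpolynomial (signedSum ε r) :=
  subpolynomial_H.mono fun n => (abs_signedSum_le_H hε hr n).trans (le_abs_self _)

theorem rpow_mul_mul_le_add {x y z : ℝ} (hx : 0 ≤ x) (hy : 0 ≤ y) (hz : 0 ≤ z) :
    (x * y * z) ^ (-(3 / 4) : ℝ) ≤ (x * y) ^ (-(9 / 8) : ℝ) + (x * z) ^ (-(9 / 8) : ℝ)
      + (y * z) ^ (-(9 / 8) : ℝ) := by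
  have hxy : 0 ≤ (x * y) ^ (-(9 / 8) : ℝ) := by positivity
  have hxz : 0 ≤ (x * z) ^ (-(9 / 8) : ℝ) := by positivity
  have hyz : 0 ≤ (y * z) ^ (-(9 / 8) : ℝ) := by positivity
  have hmean := Real.geom_mean_le_arith_mean3_weighted (w₁ := 1 / 3) (w₂ := 1 / 3) (w₃ := 1 / 3)
    (by norm_num) (by norm_num) (by norm_num) hxy hxz hyz (by norm_num)
  have hprod : (x * y * z) ^ (-(3 / 4) : ℝ) = ((x * y) ^ (-(9 / 8) : ℝ)) ^ (1 / 3 : ℝ)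
      * ((x * z) ^ (-(9 / 8) : ℝ)) ^ (1 / 3 : ℝ) * ((y * z) ^ (-(9 / 8) : ℝ)) ^ (1 / 3 : ℝ) := by
    rw [← Real.rpow_mul (by positivity), ← Real.rpow_mul (by positivity),
      ← Real.rpow_mul (by positivity), ← Real.mul_rpow (by positivity) (by positivity),
      ← Real.mul_rpow (by positivity) (by positivity),
      show x * y * (x * z) * (y * z) = (x * y * z) ^ (2 : ℝ) by rw [Real.rpow_two]; ring,
      ← Real.rpow_mul (by positivity)]
    norm_num
  linarith

theorem summable_rpow_mul_mul_sub : Summable fun x : ℤ × ℤ =>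
    (|(x.1 : ℝ)| * |(x.2 : ℝ)| * |(x.1 : ℝ) - x.2|) ^ (-(3 / 4) : ℝ) := by
  have hprod : Summable fun x : ℤ × ℤ => (|(x.1 : ℝ)| * |(x.2 : ℝ)|) ^ (-(9 / 8) : ℝ) := by
    have h := Real.summable_abs_int_rpow (b := 9 / 8) (by norm_num)
    refine (h.mul_of_nonneg h (fun _ => by positivity) fun _ => by positivity).congr fun x => ?_
    rw [Real.mul_rpow (abs_nonneg _) (abs_nonneg _)]
  have hfst := hprod.comp_injective (i := fun x : ℤ × ℤ => (x.1, x.1 - x.2))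
    fun x y h => by simp only [Prod.mk.injEq] at h; ext <;> omega
  have hsnd := hprod.comp_injective (i := fun x : ℤ × ℤ => (x.2, x.1 - x.2))
    fun x y h => by simp only [Prod.mk.injEq] at h; ext <;> omega
  refine Summable.of_nonneg_of_le (fun x => by positivity) (fun x => ?_) ((hprod.add hfst).add hsnd)
  simpa using rpow_mul_mul_le_add (abs_nonneg (x.1 : ℝ)) (abs_nonneg (x.2 : ℝ))
    (abs_nonneg ((x.1 : ℝ) - x.2))

theorem Subpolynomial.summable_kernel {α : Type*} {c : ℕ → ℝ} (hc : Subpolynomial c)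
    {f : α → ℕ × ℤ} (hf : Function.Injective f) :
    Summable fun i => c (f i).1 / ((f i).1 * (f i).2 * ((f i).1 - (f i).2)) := by
  obtain ⟨C, hC, hbound⟩ := hc.exists_abs_le (θ := 1 / 4) (by norm_num)
  have hcast : Function.Injective fun i => (((f i).1 : ℤ), (f i).2) := fun i j h => hf <| by
    simpa [Prod.ext_iff] using h
  refine Summable.of_norm_bounded ((summable_rpow_mul_mul_sub.comp_injective hcast).mul_left C)
    fun i => ?_
  simp only [Function.comp_apply, Int.cast_natCast, ← abs_mul, Real.norm_eq_abs, abs_div]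
  generalize (f i).1 = a, (f i).2 = m
  obtain ⟨t, ht⟩ : ∃ t : ℤ, t = (a : ℤ) * m * (a - m) := ⟨_, rfl⟩
  have htR : (a : ℝ) * m * (a - m) = t := by rw [ht]; push_cast; rfl
  rw [htR]
  rcases eq_or_ne t 0 with rfl | ht0
  · simp only [Int.cast_zero, abs_zero, div_zero]
    positivity
  have ha0 : a ≠ 0 := by rintro rfl; exact ht0 (by simpa using ht)
  have hat : (a : ℝ) ≤ |(t : ℝ)| := by
    exact_mod_cast Int.le_of_dvd (abs_pos.2 ht0) ((dvd_abs _ _).2 ⟨m * (a - m), by rw [ht]; ring⟩)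
  have ht_pos : 0 < |(t : ℝ)| := by positivity
  calc |c a| / |(t : ℝ)|
      ≤ C * |(t : ℝ)| ^ (1 / 4 : ℝ) / |(t : ℝ)| := by
        gcongr
        exact (hbound a ha0).trans (by gcongr)
    _ = C * |(t : ℝ)| ^ (-(3 / 4) : ℝ) := by
        rw [mul_div_assoc, ← Real.rpow_sub_one ht_pos.ne']
        norm_num

theorem sum_one_div_pow_mul_pow_of_ne {K : Type*} [Field K] {a b : K} (hab : a ≠ b) {p : ℕ}
    (hp : 1 ≤ p) : ∑ j ∈ Icc 2 p, 1 / (a ^ j * b ^ (p + 2 - j))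
      = 1 / (b ^ p * (a * (a - b))) - 1 / (a ^ p * (b * (a - b))) := by
  have hexp : ∀ j ∈ Icc 2 p, j ≠ 0 ∧ p + 2 - j ≠ 0 := fun j hj => by
    rw [Finset.mem_Icc] at hj
    omega
  rcases eq_or_ne a 0 with rfl | ha
  · rw [Finset.sum_eq_zero fun j hj => by simp [(hexp j hj).1]]
    simp [show p ≠ 0 by omega]
  rcases eq_or_ne b 0 with rfl | hb
  · rw [Finset.sum_eq_zero fun j hj => by simp [(hexp j hj).2]]
    simp [show p ≠ 0 by omega]
  have hsub : a - b ≠ 0 := sub_ne_zero.2 hab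
  clear hexp
  induction p, hp using Nat.le_induction with
  | base =>
    rw [Finset.Icc_eq_empty (by norm_num), Finset.sum_empty]
    field_simp
    ring
  | succ p hp ih =>
    have hdiv : ∑ j ∈ Icc 2 p, 1 / (a ^ j * b ^ (p + 1 + 2 - j))
        = (∑ j ∈ Icc 2 p, 1 / (a ^ j * b ^ (p + 2 - j))) / b := by
      rw [Finset.sum_div]
      refine Finset.sum_congr rfl fun j hj => ?_
      have := (Finset.mem_Icc.1 hj).2
      rw [show p + 1 + 2 - j = p + 2 - j + 1 by omega, pow_succ, ← mul_assoc, div_div]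
    rw [Finset.sum_Icc_succ_top (by omega), hdiv, ih, show p + 1 + 2 - (p + 1) = 2 by omega]
    field_simp
    ring

theorem sum_one_div_pow_mul_pow_self {K : Type*} [Field K] (a : K) {p : ℕ} (hp : 1 ≤ p) :
    ∑ j ∈ Icc 2 p, 1 / (a ^ j * a ^ (p + 2 - j)) = ((p : K) - 1) / a ^ (p + 2) := by
  have hconst : ∀ j ∈ Icc 2 p, 1 / (a ^ j * a ^ (p + 2 - j)) = 1 / a ^ (p + 2) := fun j hj => by
    rw [← pow_add, Nat.add_sub_cancel' ((Finset.mem_Icc.1 hj).2.trans (Nat.le_add_right p 2))]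
  rw [Finset.sum_congr rfl hconst, Finset.sum_const, Nat.card_Icc, nsmul_eq_mul,
    show p + 1 - 2 = p - 1 by omega, Nat.cast_sub hp, Nat.cast_one, mul_one_div]

theorem sum_div_pow_mul_div_pow {K : Type*} [Field K] [DecidableEq K] (α β a b : K) {p : ℕ}
    (hp : 1 ≤ p) : ∑ j ∈ Icc 2 p, α / a ^ j * (β / b ^ (p + 2 - j))
      = β / b ^ p * (α / (a * (a - b))) - α / a ^ p * (β / (b * (a - b)))
        + if a = b then (p - 1) * (α * β / a ^ (p + 2)) else 0 := by
  have hfactor : ∑ j ∈ Icc 2 p, α / a ^ j * (β / b ^ (p + 2 - j))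
      = α * β * ∑ j ∈ Icc 2 p, 1 / (a ^ j * b ^ (p + 2 - j)) := by
    rw [Finset.mul_sum]
    exact Finset.sum_congr rfl fun j _ => by rw [div_mul_div_comm, mul_one_div]
  rw [hfactor]
  split_ifs with hab
  · rw [hab, sum_one_div_pow_mul_pow_self _ hp]
    simp only [sub_self, mul_zero, div_zero]
    ring
  · rw [sum_one_div_pow_mul_pow_of_ne hab hp]
    simp only [div_eq_mul_inv, mul_inv]
    ring

theorem abs_div_pow_mul_div_le {e : ℝ} (he : |e| ≤ 1) (m : ℤ) {p : ℕ} (hp : 1 ≤ p) (c u d : ℝ) :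
    |e / (m : ℝ) ^ p * (c / (u * d))| ≤ |c / (m * u * d)| := by
  have hinv : |((m : ℝ) ^ p)⁻¹| ≤ |(m : ℝ)⁻¹| := by
    rcases eq_or_ne m 0 with rfl | hm
    · simp [show p ≠ 0 by omega]
    · have h1 : (1 : ℝ) ≤ |(m : ℝ)| := by exact_mod_cast Int.one_le_abs hm
      rw [abs_inv, abs_inv, abs_pow]
      gcongr
      exact le_self_pow₀ h1 (by omega)
  calc |e / (m : ℝ) ^ p * (c / (u * d))| = |e| * |((m : ℝ) ^ p)⁻¹| * |c / (u * d)| := by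
        rw [abs_mul, div_eq_mul_inv, abs_mul]
    _ ≤ 1 * |(m : ℝ)⁻¹| * |c / (u * d)| :=
        mul_le_mul_of_nonneg_right (mul_le_mul he hinv (abs_nonneg _) zero_le_one) (abs_nonneg _)
    _ = |c / (m * u * d)| := by
        rw [one_mul, ← abs_mul, mul_assoc (m : ℝ), inv_mul_eq_div, div_div, mul_comm (u * d)]

section PartialFractions

variable {c e : ℕ → ℝ} {y : ℕ → ℤ} {p : ℕ}

theorem summable_kernel_div_fst_mul (hc : Subpolynomial c) (he : ∀ n, |e n| ≤ 1)
    (hy : Function.Injective y) (hp : 1 ≤ p) : Summable fun x : ℕ × ℕ =>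
      e x.2 / (y x.2 : ℝ) ^ p * (c x.1 / (x.1 * (x.1 - y x.2))) := by
  refine Summable.of_norm_bounded (hc.summable_kernel (f := fun x => (x.1, y x.2))
    (Function.injective_id.prodMap hy)).norm fun x => ?_
  have h := abs_div_pow_mul_div_le (he x.2) (y x.2) hp (c x.1) x.1 (x.1 - y x.2)
  rwa [mul_comm (y x.2 : ℝ)] at h

theorem summable_kernel_div_snd_mul (hc : Subpolynomial c) (he : ∀ n, |e n| ≤ 1)
    (hy : Function.Injective y) (hp : 1 ≤ p) : Summable fun x : ℕ × ℕ =>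
      c x.1 / (x.1 : ℝ) ^ p * (e x.2 / (y x.2 * (x.1 - y x.2))) := by
  refine Summable.of_norm_bounded (hc.summable_kernel (f := fun x => (x.1, y x.2))
    (Function.injective_id.prodMap hy)).norm fun x => ?_
  have h := abs_div_pow_mul_div_le (he x.2) x.1 hp (c x.1) (y x.2) (x.1 - y x.2)
  rwa [Int.cast_natCast, div_mul_div_comm, mul_comm (e x.2), ← div_mul_div_comm] at h

theorem summable_div_pow_mul_tsum (hc : Subpolynomial c) (he : ∀ n, |e n| ≤ 1)
    (hy : Function.Injective y) (hp : 1 ≤ p) :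
    Summable fun b => e b / (y b : ℝ) ^ p * ∑' a : ℕ, c a / (a * (a - y b)) := by
  simpa only [tsum_mul_left, Prod.fst_swap, Prod.snd_swap] using
    (summable_kernel_div_fst_mul hc he hy hp).prod_symm.prod

theorem summable_div_int_pow (he : ∀ n, |e n| ≤ 1) (hy : Function.Injective y) {k : ℕ}
    (hk : 2 ≤ k) : Summable fun b => e b / (y b : ℝ) ^ k := by
  refine .of_norm_bounded ((Real.summable_one_div_int_pow.2 hk).comp_injective hy).norm fun b => ?_
  simpa only [Function.comp_apply, norm_div, Real.norm_eq_abs, abs_one] using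
    div_le_div_of_nonneg_right (he b) (abs_nonneg _)

theorem sum_mul_tsum_of_injective (hc : Subpolynomial c) (he : ∀ n, |e n| ≤ 1)
    (hy : Function.Injective y) (hp : 1 ≤ p) :
    ∑ j ∈ Icc 2 p, (∑' a : ℕ, c a / (a : ℝ) ^ j) * ∑' b, e b / (y b : ℝ) ^ (p + 2 - j)
      = ∑' b, e b / (y b : ℝ) ^ p * ∑' a : ℕ, c a / (a * (a - y b))
        - ∑' a : ℕ, c a / (a : ℝ) ^ p * ∑' b, e b / (y b * (a - y b))
        + ∑' x : ℕ × ℕ, if (x.1 : ℝ) = y x.2 then (p - 1) * (c x.1 * e x.2 / (x.1 : ℝ) ^ (p + 2))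
          else 0 := by
  have hleft := summable_kernel_div_fst_mul hc he hy hp
  have hright := summable_kernel_div_snd_mul hc he hy hp
  have hfst : ∀ j ∈ Icc 2 p, Summable fun a : ℕ => ‖c a / (a : ℝ) ^ j‖ := fun j hj =>
    (hc.summable_div_pow (Finset.mem_Icc.1 hj).1).norm
  have hsnd : ∀ j ∈ Icc 2 p, Summable fun b => ‖e b / (y b : ℝ) ^ (p + 2 - j)‖ := fun j hj =>
    (summable_div_int_pow he hy (by have := (Finset.mem_Icc.1 hj).2; omega)).norm
  have hprod := fun j hj => summable_mul_of_summable_norm (hfst j hj) (hsnd j hj)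
  have hdiag := ((summable_sum hprod).sub (hleft.sub hright)).congr fun x => sub_eq_of_eq_add' <|
    sum_div_pow_mul_div_pow (c x.1) (e x.2) (x.1 : ℝ) (y x.2) hp
  have hswap : ∑' x : ℕ × ℕ, e x.2 / (y x.2 : ℝ) ^ p * (c x.1 / (x.1 * (x.1 - y x.2)))
      = ∑' b, ∑' a : ℕ, e b / (y b : ℝ) ^ p * (c a / (a * (a - y b))) :=
    ((Equiv.prodComm ℕ ℕ).tsum_eq _).symm.trans hleft.prod_symm.tsum_prod
  simp only [← tsum_mul_left]
  rw [← hswap, ← hright.tsum_prod, ← hleft.tsum_sub hright, ← (hleft.sub hright).tsum_add hdiag]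
  refine Eq.trans ?_ (tsum_congr fun x => sum_div_pow_mul_div_pow (c x.1) (e x.2) x.1 (y x.2) hp)
  rw [Summable.tsum_finsetSum hprod]
  refine Finset.sum_congr rfl fun j hj => ?_
  rw [tsum_mul_left]
  exact tsum_mul_tsum_of_summable_norm (hfst j hj) (hsnd j hj)

theorem sum_mul_tsum_sub (hc : Subpolynomial c) (he : ∀ n, |e n| ≤ 1) (hp : 1 ≤ p) :
    ∑ j ∈ Icc 2 p, (∑' a : ℕ, c a / (a : ℝ) ^ j) * ∑' b : ℕ, e b / (b : ℝ) ^ (p + 2 - j)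
      = ∑' b : ℕ, e b / (b : ℝ) ^ p * ∑' a : ℕ, c a / (a * (a - b))
        - ∑' a : ℕ, c a / (a : ℝ) ^ p * ∑' b : ℕ, e b / (b * (a - b))
        + (p - 1) * ∑' a : ℕ, c a * e a / (a : ℝ) ^ (p + 2) := by
  have hdiag : ∑' x : ℕ × ℕ, (if (x.1 : ℝ) = x.2 then
      (p - 1) * (c x.1 * e x.2 / (x.1 : ℝ) ^ (p + 2)) else 0)
      = (p - 1) * ∑' a : ℕ, c a * e a / (a : ℝ) ^ (p + 2) := by
    have hinj : Function.Injective fun a : ℕ => (a, a) := fun a b h => congrArg Prod.fst h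
    rw [← hinj.tsum_eq, ← tsum_mul_left]
    · simp
    · rintro ⟨a, b⟩ h
      have hab : a = b := by_contra fun hne => h (by simp [hne])
      exact ⟨a, by rw [hab]⟩
  simpa only [hdiag, Int.cast_natCast] using
    sum_mul_tsum_of_injective hc he Nat.cast_injective hp

theorem sum_mul_tsum_add (hc : Subpolynomial c) (he : ∀ n, |e n| ≤ 1) (hp : 1 ≤ p) :
    ∑ j ∈ Icc 2 p,
        (-1) ^ j * ((∑' a : ℕ, c a / (a : ℝ) ^ j) * ∑' b : ℕ, e b / (b : ℝ) ^ (p + 2 - j))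
      = ∑' b : ℕ, e b / (b : ℝ) ^ p * ∑' a : ℕ, c a / (a * (a + b))
        + (-1) ^ p * ∑' a : ℕ, c a / (a : ℝ) ^ p * ∑' b : ℕ, e b / (b * (a + b)) := by
  have hinj : Function.Injective fun b : ℕ => -(b : ℤ) := neg_injective.comp Nat.cast_injective
  have hdiag : ∑' x : ℕ × ℕ, (if (x.1 : ℝ) = (-(x.2 : ℤ) : ℤ) then
      (p - 1) * (c x.1 * e x.2 / (x.1 : ℝ) ^ (p + 2)) else 0) = 0 := by
    refine (tsum_congr fun x => ?_).trans tsum_zero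
    split_ifs with h
    · have hx : (x.1 : ℤ) = -x.2 := by exact_mod_cast h
      simp [show x.1 = 0 by omega]
    · rfl
  have hneg : ∀ k b : ℕ, e b / ((-(b : ℤ) : ℤ) : ℝ) ^ k = (-1) ^ k * (e b / (b : ℝ) ^ k) :=
    fun k b => by
      rw [Int.cast_neg, Int.cast_natCast, neg_pow]
      rcases neg_one_pow_eq_or ℝ k with hk | hk <;> rw [hk] <;> ring
  have hsign : ∀ j ∈ Icc 2 p, (-1 : ℝ) ^ j = (-1) ^ p * (-1) ^ (p + 2 - j) := fun j hj => by
    have := (Finset.mem_Icc.1 hj).2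
    rw [← pow_add]
    exact neg_one_pow_congr (by simp only [Nat.even_iff]; omega)
  have hkernel : ∀ a b : ℕ, e b / ((-(b : ℤ) : ℤ) * ((a : ℝ) - (-(b : ℤ) : ℤ)))
      = -(e b / (b * (a + b))) := fun a b => by
    rw [Int.cast_neg, Int.cast_natCast, sub_neg_eq_add, neg_mul, div_neg]
  have h := sum_mul_tsum_of_injective hc he hinj hp
  simp only [hdiag, hneg, hkernel, tsum_mul_left, tsum_neg, add_zero, mul_assoc] at h
  simp only [Int.cast_neg, Int.cast_natCast, sub_neg_eq_add, mul_neg, tsum_neg] at h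
  have hone : (-1 : ℝ) ^ p * (-1) ^ p = 1 := by rw [← mul_pow]; simp
  calc _ = (-1) ^ p * ∑ j ∈ Icc 2 p, (∑' a : ℕ, c a / (a : ℝ) ^ j)
          * ((-1) ^ (p + 2 - j) * ∑' b : ℕ, e b / (b : ℝ) ^ (p + 2 - j)) := by
        rw [Finset.mul_sum]
        refine Finset.sum_congr rfl fun j hj => ?_
        rw [hsign j hj]
        ring
    _ = _ := by
        rw [h]
        linear_combination (∑' b : ℕ, e b / (b : ℝ) ^ p * ∑' a : ℕ, c a / (a * (a + b))) * hone

end PartialFractions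

/-- The discrete Hilbert transform `∑_a c a (1 / (a - y) - 1 / a)` of a sequence `c`, the
subtracted term making the series converge. Since `0⁻¹ = 0`, the poles `1 / a` at `a = 0` and
`1 / (a - y)` at `a = y` are left out. -/
noncomputable def hilbertSum (c : ℕ → ℝ) (y : ℤ) : ℝ :=
  ∑' a : ℕ, c a * (((a : ℝ) - y)⁻¹ - (a : ℝ)⁻¹)

theorem hilbertSum_zero (c : ℕ → ℝ) : hilbertSum c 0 = 0 := by simp [hilbertSum]

theorem div_mul_sub_eq {K : Type*} [Field K] [DecidableEq K] (γ a : K) {y : K} (hy : y ≠ 0) :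
    γ / (a * (a - y))
      = (γ * ((a - y)⁻¹ - a⁻¹) + ((if a = 0 then γ else 0) + if a = y then γ else 0) / y) / y := by
  rcases eq_or_ne a 0 with rfl | ha
  · simp [hy.symm, div_eq_mul_inv]
  rcases eq_or_ne a y with rfl | hay
  · simp [hy, div_eq_mul_inv]
  · have hsub : a - y ≠ 0 := sub_ne_zero.2 hay
    rw [if_neg ha, if_neg hay]
    field_simp
    ring

namespace Subpolynomial

variable {c δ : ℕ → ℝ} {σ s : ℝ} {b : ℕ}

theorem summable_div_mul_sub (hc : Subpolynomial c) (y : ℤ) :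
    Summable fun a : ℕ => c a / (a * ((a : ℝ) - y)) := by
  rcases eq_or_ne y 0 with rfl | hy
  · simpa [sq] using hc.summable_div_pow le_rfl
  have hy' : (y : ℝ) ≠ 0 := Int.cast_ne_zero.2 hy
  refine ((hc.summable_kernel (f := fun a => (a, y)) fun _ _ => congrArg Prod.fst).mul_left
    (y : ℝ)).congr fun a => ?_
  rw [mul_comm (a : ℝ), mul_assoc, ← div_div, div_right_comm, mul_div_cancel₀ _ hy']

theorem summable_hilbertSum (hc : Subpolynomial c) (y : ℤ) :
    Summable fun a : ℕ => c a * (((a : ℝ) - y)⁻¹ - (a : ℝ)⁻¹) := by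
  refine ((hc.summable_div_mul_sub y).mul_left (y : ℝ)).congr_atTop ?_
  filter_upwards [eventually_gt_atTop y.natAbs] with a ha
  have ha0 : (a : ℝ) ≠ 0 := Nat.cast_ne_zero.2 (by omega)
  have hay : (a : ℝ) - y ≠ 0 := by
    exact_mod_cast (show (a : ℤ) - y ≠ 0 by omega)
  field_simp
  ring

theorem tsum_div_mul_sub_int (hc : Subpolynomial c) {y : ℤ} (hy : y ≠ 0) {γ : ℝ}
    (hpole : HasSum (fun a : ℕ => if (a : ℝ) = y then c a else 0) γ) :
    ∑' a : ℕ, c a / (a * ((a : ℝ) - y)) = (hilbertSum c y + (c 0 + γ) / y) / y := by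
  have hzero : HasSum (fun a : ℕ => if (a : ℝ) = 0 then c a else 0) (c 0) := by
    simpa using hasSum_single (f := fun a : ℕ => if (a : ℝ) = 0 then c a else 0) 0
      fun a ha => if_neg (Nat.cast_ne_zero.2 ha)
  rw [tsum_congr fun a : ℕ => div_mul_sub_eq (c a) (a : ℝ) (Int.cast_ne_zero.2 hy)]
  exact (((hc.summable_hilbertSum y).hasSum.add
    ((hzero.add hpole).div_const (y : ℝ))).div_const (y : ℝ)).tsum_eq

theorem tsum_div_mul_sub (hc : Subpolynomial c) (hb : b ≠ 0) :
    ∑' a : ℕ, c a / (a * (a - b)) = (hilbertSum c b + (c 0 + c b) / b) / b := by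
  have hpole : HasSum (fun a : ℕ => if (a : ℝ) = (b : ℤ) then c a else 0) (c b) := by
    simpa using hasSum_single (f := fun a : ℕ => if (a : ℝ) = (b : ℤ) then c a else 0) b
      fun a ha => if_neg (by exact_mod_cast ha)
  simpa only [Int.cast_natCast] using hc.tsum_div_mul_sub_int (Int.natCast_ne_zero.2 hb) hpole

theorem tsum_div_mul_add (hc : Subpolynomial c) (hb : b ≠ 0) :
    ∑' a : ℕ, c a / (a * (a + b)) = (c 0 / b - hilbertSum c (-b)) / b := by
  have hpole : HasSum (fun a : ℕ => if (a : ℝ) = (-b : ℤ) then c a else 0) 0 := by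
    have hne : ∀ a : ℕ, (a : ℝ) ≠ (-b : ℤ) := fun a => by
      exact_mod_cast (show (a : ℤ) ≠ -b by omega)
    simp only [if_neg (hne _), hasSum_zero]
  have h := hc.tsum_div_mul_sub_int (neg_ne_zero.2 (Int.natCast_ne_zero.2 hb)) hpole
  simp only [Int.cast_neg, Int.cast_natCast, sub_neg_eq_add, add_zero, div_neg] at h
  rw [h]
  ring

theorem hilbertSum_div (hc : Subpolynomial c) (y : ℤ) :
    hilbertSum (fun a => c a / a) y
      = ∑' a : ℕ, c a / (a * ((a : ℝ) - y)) - ∑' a : ℕ, c a / (a : ℝ) ^ 2 := by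
  rw [← (hc.summable_div_mul_sub y).tsum_sub (hc.summable_div_pow le_rfl)]
  refine tsum_congr fun a => ?_
  simp only [div_eq_mul_inv, mul_inv, sq]
  ring

/-- The shift `a ↦ a + 1` of the summation index turns a recurrence for `c` into one for its
Hilbert transform. -/
theorem hilbertSum_add_one (hc : Subpolynomial c) (hδ : Subpolynomial δ) (hzero : c 0 = δ 0)
    (hsucc : ∀ a, c (a + 1) = σ * c a + δ (a + 1)) (y : ℤ) :
    hilbertSum c (y + 1) = σ * (hilbertSum c y - hilbertSum c (-1)) + hilbertSum δ (y + 1) := by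
  have hsum := (hc.summable_hilbertSum (y + 1)).sub (hδ.summable_hilbertSum (y + 1))
  rw [← sub_eq_iff_eq_add]
  simp only [hilbertSum]
  rw [← (hc.summable_hilbertSum (y + 1)).tsum_sub (hδ.summable_hilbertSum (y + 1)),
    ← (hc.summable_hilbertSum y).tsum_sub (hc.summable_hilbertSum (-1)), ← tsum_mul_left,
    hsum.tsum_eq_zero_add, hzero, sub_self, zero_add]
  refine tsum_congr fun a => ?_
  rw [hsucc]
  push_cast
  rw [add_sub_add_right_eq_sub, sub_neg_eq_add]
  ring

theorem hilbertSum_neg_one (hc : Subpolynomial c)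
    (hsucc : ∀ a, c (a + 1) = c a + δ (a + 1)) (hδ : HasSum (fun a : ℕ => δ a / a) s) :
    hilbertSum c (-1) = -s := by
  have hparts : ∀ M : ℕ, c M * ((M : ℝ) + 1)⁻¹ - ∑ a ∈ range (M + 1), δ a / a
      = ∑ a ∈ range (M + 1), c a * (((a : ℝ) - (-1 : ℤ))⁻¹ - (a : ℝ)⁻¹) := fun M => by
    induction M with
    | zero => simp
    | succ M ih =>
      rw [Finset.sum_range_succ, Finset.sum_range_succ _ (M + 1), ← ih, hsucc]
      push_cast
      rw [sub_neg_eq_add]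
      ring
  have hleft := (hc.tendsto_mul_inv_add 1).sub
    ((tendsto_add_atTop_iff_nat 1).2 hδ.tendsto_sum_nat)
  rw [zero_sub] at hleft
  exact tendsto_nhds_unique ((tendsto_add_atTop_iff_nat 1).2
    (hc.summable_hilbertSum (-1)).hasSum.tendsto_sum_nat) (hleft.congr hparts)

end Subpolynomial

theorem hasSum_conditional_iff {f : ℕ → ℝ} {s : ℝ} :
    HasSum f s (SummationFilter.conditional ℕ)
      ↔ Tendsto (fun n => ∑ i ∈ range n, f i) atTop (𝓝 s) := by
  rw [HasSum, SummationFilter.conditional_filter_eq_map_range, tendsto_map'_iff]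
  rfl

theorem sum_range_zetaBarTerm (s n : ℕ) : ∑ i ∈ range n, zetaBarTerm s i = L s n := by
  induction n with
  | zero => simp [L_zero]
  | succ n ih => rw [Finset.sum_range_succ, ih, L_succ, zetaBarTerm]

theorem summable_zetaBarTerm {s : ℕ} (hs : 1 ≤ s) :
    Summable (zetaBarTerm s) (SummationFilter.conditional ℕ) := by
  obtain ⟨l, hl⟩ := exists_tendsto_L hs
  exact ⟨l, hasSum_conditional_iff.2 (hl.congr fun n => (sum_range_zetaBarTerm s n).symm)⟩

theorem tendsto_L {s : ℕ} (hs : 1 ≤ s) : Tendsto (L s) atTop (𝓝 (zetaBar s)) :=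
  (hasSum_conditional_iff.1 (summable_zetaBarTerm hs).hasSum).congr (sum_range_zetaBarTerm s)

theorem zetaBar_one : zetaBar 1 = Real.log 2 :=
  tendsto_nhds_unique (tendsto_L le_rfl) tendsto_L_one

theorem hasSum_one_div_pow {s : ℕ} (hs : 2 ≤ s) :
    HasSum (fun n : ℕ => 1 / (n : ℝ) ^ s) (zeta s) := by
  have h : Summable fun n : ℕ => 1 / (n : ℝ) ^ s := Real.summable_one_div_nat_pow.2 (by omega)
  have hzeta : ∑' n : ℕ, 1 / (n : ℝ) ^ s = zeta s := by
    rw [zeta, h.tsum_eq_zero_add]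
    simp [show s ≠ 0 by omega]
  exact hzeta ▸ h.hasSum

theorem hasSum_neg_one_pow_div_pow {s : ℕ} (hs : 2 ≤ s) :
    HasSum (fun n : ℕ => (-1) ^ n / (n : ℝ) ^ s) (-zetaBar s) := by
  have hsum : Summable fun n : ℕ => (-1) ^ n / (n : ℝ) ^ s :=
    (Subpolynomial.of_abs_le_one fun n => by simp).summable_div_pow hs
  have hpartial : ∀ n, -L s n = ∑ i ∈ range (n + 1), (-1) ^ i / (i : ℝ) ^ s := fun n => by
    induction n with
    | zero => simp [L_zero, show s ≠ 0 by omega]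
    | succ n ih =>
      rw [Finset.sum_range_succ, ← ih, L_succ]
      push_cast
      ring
  rw [hsum.hasSum_iff_tendsto_nat, ← tendsto_add_atTop_iff_nat 1]
  exact (tendsto_L (by omega)).neg.congr hpartial

theorem zetaBar_two : zetaBar 2 = zeta 2 / 2 := by
  have heven : HasSum (fun k : ℕ => 1 / ((2 * k : ℕ) : ℝ) ^ 2) (zeta 2 / 4) := by
    refine ((hasSum_one_div_pow le_rfl).div_const 4).congr_fun fun k => ?_
    push_cast
    ring
  have hodd : Summable fun k : ℕ => 1 / ((2 * k + 1 : ℕ) : ℝ) ^ 2 :=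
    (hasSum_one_div_pow le_rfl).summable.comp_injective (i := fun k : ℕ => 2 * k + 1)
      fun a b h => by simpa using h
  have hzeta := heven.even_add_odd (f := fun n : ℕ => 1 / (n : ℝ) ^ 2) hodd.hasSum
  have hbar := HasSum.even_add_odd (f := fun n : ℕ => (-1) ^ n / (n : ℝ) ^ 2)
    (by simpa only [pow_mul, neg_one_sq, one_pow] using heven)
    (by simpa only [pow_succ _ (2 * _), pow_mul, neg_one_sq, one_pow, one_mul, neg_div]
      using hodd.hasSum.neg)
  have h₁ := (hasSum_one_div_pow le_rfl).unique hzeta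
  have h₂ := (hasSum_neg_one_pow_div_pow le_rfl).unique hbar
  linarith

section Sign

variable {ε : ℝ}

theorem abs_le_one_of_mem (hε : ε ∈ ({1, -1} : Set ℝ)) : |ε| ≤ 1 := by
  rcases hε with rfl | rfl <;> simp

theorem sq_eq_one_of_mem (hε : ε ∈ ({1, -1} : Set ℝ)) : ε ^ 2 = 1 := by
  rcases hε with rfl | rfl <;> simp

theorem subpolynomial_pow (hε : |ε| ≤ 1) : Subpolynomial fun n => ε ^ n :=
  .of_abs_le_one fun n => by
    rw [abs_pow]
    exact pow_le_one₀ (abs_nonneg ε) hε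

theorem subpolynomial_single : Subpolynomial (Pi.single 0 1) := .of_abs_le_one fun n => by
  rcases eq_or_ne n 0 with rfl | hn <;> simp [*]

theorem hilbertSum_single (y : ℤ) : hilbertSum (Pi.single 0 1) y = -1 / y := by
  rw [hilbertSum, tsum_eq_single 0 fun a ha => by simp [ha]]
  simp [div_eq_mul_inv]

theorem hilbertSum_pow_neg_one (hε : ε ∈ ({1, -1} : Set ℝ)) :
    hilbertSum (fun a => ε ^ a) (-1) = (1 - ε) * Real.log 2 := by
  have hc := subpolynomial_pow (abs_le_one_of_mem hε)
  rcases hε with rfl | rfl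
  · have hδ : HasSum (fun a : ℕ => (Pi.single 0 1 : ℕ → ℝ) a / a) 0 := by
      simpa using hasSum_single (f := fun a : ℕ => (Pi.single 0 1 : ℕ → ℝ) a / a) 0
        fun a ha => by simp [ha]
    simpa using hc.hilbertSum_neg_one (fun a => by simp) hδ
  · have hpartial : ∀ M, L 1 (M + 1) + L 1 M
        = ∑ a ∈ range (M + 1), (-1) ^ a * (((a : ℝ) - (-1 : ℤ))⁻¹ - (a : ℝ)⁻¹) := fun M => by
      induction M with
      | zero => simp [L_succ, L_zero]
      | succ M ih =>
        rw [Finset.sum_range_succ, ← ih, L_succ 1 (M + 1), L_succ 1 M]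
        push_cast
        ring
    have hlim := ((tendsto_add_atTop_iff_nat 1).2 tendsto_L_one).add tendsto_L_one
    rw [hilbertSum, tendsto_nhds_unique ((tendsto_add_atTop_iff_nat 1).2
      (hc.summable_hilbertSum (-1)).hasSum.tendsto_sum_nat) (hlim.congr hpartial)]
    ring

theorem hilbertSum_pow_add_one (hε : ε ∈ ({1, -1} : Set ℝ)) (y : ℤ) :
    hilbertSum (fun a => ε ^ a) (y + 1)
      = ε * (hilbertSum (fun a => ε ^ a) y - (1 - ε) * Real.log 2) - 1 / (y + 1) := by
  rw [(subpolynomial_pow (abs_le_one_of_mem hε)).hilbertSum_add_one subpolynomial_single (σ := ε)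
    (by simp) (fun a => by simp [pow_succ']), hilbertSum_single, hilbertSum_pow_neg_one hε]
  push_cast
  ring

theorem hilbertSum_pow (hε : ε ∈ ({1, -1} : Set ℝ)) (b : ℕ) :
    hilbertSum (fun a => ε ^ a) b = (1 - ε ^ b) * Real.log 2 - ε ^ b * signedSum ε 1 b := by
  induction b with
  | zero => simp [hilbertSum_zero, signedSum_zero]
  | succ b ih =>
    have hsq : (ε ^ (b + 1)) ^ 2 = 1 := by rw [pow_right_comm, sq_eq_one_of_mem hε, one_pow]
    push_cast
    rw [hilbertSum_pow_add_one hε, ih, signedSum_succ]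
    push_cast
    linear_combination Real.log 2 * sq_eq_one_of_mem hε + 1 / ((b : ℝ) + 1) * hsq

theorem hilbertSum_pow_neg (hε : ε ∈ ({1, -1} : Set ℝ)) (b : ℕ) :
    hilbertSum (fun a => ε ^ a) (-b) = hilbertSum (fun a => ε ^ a) b + 1 / b := by
  induction b with
  | zero => simp
  | succ b ih =>
    have hright := hilbertSum_pow_add_one hε b
    have hleft := hilbertSum_pow_add_one hε (-(b + 1 : ℕ))
    rw [show -((b + 1 : ℕ) : ℤ) + 1 = -b by push_cast; ring, ih, Int.cast_neg, Int.cast_natCast,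
      show -((b + 1 : ℕ) : ℝ) + 1 = -b by push_cast; ring, div_neg] at hleft
    push_cast at hleft hright ⊢
    linear_combination -ε * hleft - hright - (hilbertSum (fun a => ε ^ a) (-(b + 1))
      + ε * Real.log 2) * sq_eq_one_of_mem hε

theorem tsum_pow_div_mul_add (hε : ε ∈ ({1, -1} : Set ℝ)) {b : ℕ} (hb : b ≠ 0) :
    ∑' a : ℕ, ε ^ a / (a * (a + b) : ℝ)
      = (ε ^ b * signedSum ε 1 b - (1 - ε ^ b) * Real.log 2) / b := by
  rw [(subpolynomial_pow (abs_le_one_of_mem hε)).tsum_div_mul_add hb, hilbertSum_pow_neg hε,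
    hilbertSum_pow hε]
  ring

theorem tsum_pow_div_mul_sub (hε : ε ∈ ({1, -1} : Set ℝ)) {b : ℕ} (hb : b ≠ 0) :
    ∑' a : ℕ, ε ^ a / (a * (a - b) : ℝ)
      = ((1 - ε ^ b) * Real.log 2 - ε ^ b * signedSum ε 1 b + (1 + ε ^ b) / b) / b := by
  rw [(subpolynomial_pow (abs_le_one_of_mem hε)).tsum_div_mul_sub hb, hilbertSum_pow hε, pow_zero]

theorem tsum_pow_div_mul_sub_left (hε : ε ∈ ({1, -1} : Set ℝ)) {a : ℕ} (ha : a ≠ 0) :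
    ∑' b : ℕ, ε ^ b / (b * (a - b) : ℝ)
      = (ε ^ a * signedSum ε 1 a - (1 - ε ^ a) * Real.log 2 - (1 + ε ^ a) / a) / a := by
  have hneg : ∀ b : ℕ, ε ^ b / (b * (a - b) : ℝ) = -(ε ^ b / (b * (b - a) : ℝ)) := fun b => by
    rw [← neg_sub (b : ℝ), mul_neg, div_neg]
  rw [tsum_congr hneg, tsum_neg, tsum_pow_div_mul_sub hε ha]
  ring

theorem tsum_one_div_mul_add {a : ℕ} (ha : a ≠ 0) :
    ∑' b : ℕ, 1 / (b * (a + b) : ℝ) = signedSum 1 1 a / a := by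
  simpa [add_comm] using tsum_pow_div_mul_add (ε := 1) (by simp) ha

theorem tsum_one_div_mul_sub {a : ℕ} (ha : a ≠ 0) :
    ∑' b : ℕ, 1 / (b * (a - b) : ℝ) = (signedSum 1 1 a - 2 / a) / a := by
  simpa [one_add_one_eq_two] using tsum_pow_div_mul_sub_left (ε := 1) (by simp) ha

end Sign

theorem subpolynomial_neg_one_pow : Subpolynomial fun n => (-1) ^ n :=
  subpolynomial_pow (by simp)

theorem subpolynomial_neg_one_pow_div : Subpolynomial fun n : ℕ => (-1) ^ n / (n : ℝ) :=
  .of_abs_le_one fun n => by simpa [abs_div] using Nat.cast_inv_le_one n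

theorem hilbertSum_neg_one_pow_div (y : ℤ) : hilbertSum (fun a => (-1) ^ a / a) y
    = ∑' a : ℕ, (-1) ^ a / (a * ((a : ℝ) - y)) + zetaBar 2 := by
  rw [subpolynomial_neg_one_pow.hilbertSum_div, (hasSum_neg_one_pow_div_pow le_rfl).tsum_eq,
    sub_neg_eq_add]

theorem hilbertSum_signedSum_neg_one (b : ℕ) : hilbertSum (signedSum (-1) 1) b
    = Real.log 2 * (signedSum 1 1 b - signedSum (-1) 1 b) + signedSum (-1) 2 b
      + (signedSum 1 2 b - signedSum (-1) 1 b ^ 2) / 2 := by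
  have hc : Subpolynomial (signedSum (-1) 1) := subpolynomial_signedSum (by simp) le_rfl
  have hδ : HasSum (fun a : ℕ => (-1) ^ a / (a : ℝ) / a) (-zetaBar 2) := by
    simpa only [div_div, ← sq] using hasSum_neg_one_pow_div_pow le_rfl
  have hsucc : ∀ a : ℕ, signedSum (-1) 1 (a + 1)
      = signedSum (-1) 1 a + (-1) ^ (a + 1) / ((a + 1 : ℕ) : ℝ) := fun a => by
    rw [signedSum_succ, pow_one, Nat.cast_succ]
  induction b with
  | zero => simp [hilbertSum_zero, signedSum_zero]
  | succ b ih =>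
    have hsq : ((-1 : ℝ) ^ (b + 1)) ^ 2 = 1 := by rw [pow_right_comm, neg_one_sq, one_pow]
    have hQ := tsum_pow_div_mul_sub (ε := -1) (by simp) (Nat.add_one_ne_zero b)
    have hstep := hc.hilbertSum_add_one subpolynomial_neg_one_pow_div (σ := 1)
      (by simp [signedSum_zero]) (by simpa only [one_mul] using hsucc) b
    rw [hc.hilbertSum_neg_one hsucc hδ, hilbertSum_neg_one_pow_div, ih] at hstep
    push_cast at hQ hstep ⊢
    rw [hstep, hQ]
    simp only [signedSum_succ, pow_one, div_eq_mul_inv, ← inv_pow]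
    linear_combination -(1 / 2) * ((b : ℝ) + 1)⁻¹ ^ 2 * hsq

theorem hilbertSum_sub_hilbertSum_neg (b : ℕ) :
    hilbertSum (fun a => (-1) ^ a * signedSum 1 1 a) b
        - hilbertSum (fun a => (-1) ^ a * signedSum 1 1 a) (-b)
      = (-1) ^ b * (signedSum 1 2 b + signedSum (-1) 2 b - zetaBar 2)
        - ∑' a : ℕ, (-1) ^ a / (a * (a + b) : ℝ) := by
  have hc : Subpolynomial fun a => (-1) ^ a * signedSum 1 1 a :=
    subpolynomial_neg_one_pow.mul (subpolynomial_signedSum (by simp) le_rfl)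
  have hrec := hc.hilbertSum_add_one subpolynomial_neg_one_pow_div (σ := -1)
    (by simp [signedSum_zero]) fun a => by
      rw [signedSum_succ, one_pow, pow_one, Nat.cast_succ, pow_succ]
      ring
  induction b with
  | zero =>
    have h := (hasSum_neg_one_pow_div_pow le_rfl).tsum_eq
    simp only [sq] at h
    simp [hilbertSum_zero, signedSum_zero, h]
  | succ b ih =>
    have hsq : ((-1 : ℝ) ^ (b + 1)) ^ 2 = 1 := by rw [pow_right_comm, neg_one_sq, one_pow]
    have hP := tsum_pow_div_mul_add (ε := -1) (by simp) (Nat.add_one_ne_zero b)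
    have hQ := tsum_pow_div_mul_sub (ε := -1) (by simp) (Nat.add_one_ne_zero b)
    have hright := hrec b
    have hleft := hrec (-(b + 1 : ℕ))
    rw [show -((b + 1 : ℕ) : ℤ) + 1 = -b by push_cast; ring] at hleft
    simp only [hilbertSum_neg_one_pow_div] at hleft hright
    push_cast at hP hQ hleft hright ⊢
    simp only [sub_neg_eq_add] at hleft
    simp only [signedSum_succ, one_pow, div_eq_mul_inv, ← inv_pow] at hP hQ hleft hright ih ⊢
    linear_combination hright - hleft - ih + hQ + hP - ((b : ℝ) + 1)⁻¹ ^ 2 * hsq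

theorem hasSum_succ_iff {f g : ℕ → ℝ} {s : ℝ} (hzero : f 0 = 0) (hsucc : ∀ n, g n = f (n + 1)) :
    HasSum g s ↔ HasSum f s := by
  simpa [hzero, funext hsucc] using hasSum_nat_add_iff' (f := f) (g := s) 1

theorem hasSum_zetaBar {s : ℕ} (hs : 2 ≤ s) :
    HasSum (fun n : ℕ => -((-1) ^ n / (n : ℝ) ^ s)) (zetaBar s) := by
  simpa only [neg_neg] using (hasSum_neg_one_pow_div_pow hs).neg

section ZetaStar

variable {ε₁ ε₂ : ℝ} {q r : ℕ}

theorem hasSum_zetaStarTerm_iff {s : ℝ} : HasSum (zetaStarTerm ε₁ ε₂ q r) s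
    ↔ HasSum (fun n : ℕ => ε₁ ^ n * signedSum ε₂ r n / (n : ℝ) ^ q) s :=
  hasSum_succ_iff (by simp [signedSum_zero]) fun n => by
    rw [zetaStarTerm, signedSum, Nat.cast_succ, div_mul_eq_mul_div]

theorem summable_zetaStarTerm (h₁ : |ε₁| ≤ 1) (h₂ : |ε₂| ≤ 1) (hq : 2 ≤ q) (hr : 1 ≤ r) :
    Summable (zetaStarTerm ε₁ ε₂ q r) :=
  (hasSum_zetaStarTerm_iff.2 (((subpolynomial_pow h₁).mul
    (subpolynomial_signedSum h₂ hr)).summable_div_pow hq).hasSum).summable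

theorem hasSum_zetaStar (h₁ : |ε₁| ≤ 1) (h₂ : |ε₂| ≤ 1) (hq : 2 ≤ q) (hr : 1 ≤ r) :
    HasSum (fun n : ℕ => ε₁ ^ n * signedSum ε₂ r n / (n : ℝ) ^ q) (zetaStar ε₁ ε₂ q r) :=
  hasSum_zetaStarTerm_iff.1 (summable_zetaStarTerm h₁ h₂ hq hr).hasSum

theorem hasSum_altLSqTerm_iff {s : ℝ} : HasSum (altLSqTerm q) s
    ↔ HasSum (fun n : ℕ => -((-1) ^ n * signedSum (-1) 1 n ^ 2 / (n : ℝ) ^ q)) s :=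
  hasSum_succ_iff (by simp [signedSum_zero]) fun n => by
    rw [altLSqTerm, signedSum_neg_one, Nat.cast_succ, pow_succ (-1 : ℝ)]
    ring

theorem hasSum_altHSqTerm_iff {s : ℝ} : HasSum (altHSqTerm q) s
    ↔ HasSum (fun n : ℕ => -((-1) ^ n * signedSum 1 1 n ^ 2 / (n : ℝ) ^ q)) s :=
  hasSum_succ_iff (by simp [signedSum_zero]) fun n => by
    rw [altHSqTerm, signedSum_one, H, Nat.cast_succ, pow_succ (-1 : ℝ)]
    ring

theorem summable_neg_one_pow_mul_sq {c : ℕ → ℝ} (hc : Subpolynomial c) (hq : 2 ≤ q) :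
    Summable fun n : ℕ => -((-1) ^ n * c n ^ 2 / (n : ℝ) ^ q) := by
  simpa only [sq] using ((subpolynomial_neg_one_pow.mul (hc.mul hc)).summable_div_pow hq).neg

theorem summable_altLSqTerm (hq : 2 ≤ q) : Summable (altLSqTerm q) :=
  (hasSum_altLSqTerm_iff.2 (summable_neg_one_pow_mul_sq
    (subpolynomial_signedSum (by simp) le_rfl) hq).hasSum).summable

theorem summable_altHSqTerm (hq : 2 ≤ q) : Summable (altHSqTerm q) :=
  (hasSum_altHSqTerm_iff.2 (summable_neg_one_pow_mul_sq
    (subpolynomial_signedSum (by simp) le_rfl) hq).hasSum).summable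

theorem hasSum_altLSq (hq : 2 ≤ q) :
    HasSum (fun n : ℕ => (-1) ^ n * signedSum (-1) 1 n ^ 2 / (n : ℝ) ^ q)
      (-∑' n, altLSqTerm q n) := by
  simpa only [neg_neg] using (hasSum_altLSqTerm_iff.1 (summable_altLSqTerm hq).hasSum).neg

theorem hasSum_altHSq (hq : 2 ≤ q) :
    HasSum (fun n : ℕ => (-1) ^ n * signedSum 1 1 n ^ 2 / (n : ℝ) ^ q)
      (-∑' n, altHSqTerm q n) := by
  simpa only [neg_neg] using (hasSum_altHSqTerm_iff.1 (summable_altHSqTerm hq).hasSum).neg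

end ZetaStar

section Relations

theorem div_pow_mul_of_eq_div {n p : ℕ} (hp : 1 ≤ p) (c : ℝ) {t u : ℝ} (h : n ≠ 0 → t = u / n) :
    c / (n : ℝ) ^ p * t = c * u / (n : ℝ) ^ (p + 1) := by
  rcases eq_or_ne n 0 with rfl | hn
  · simp [show p ≠ 0 by omega]
  · rw [h hn, pow_succ, div_mul_div_comm]

variable {p : ℕ}

theorem tsum_neg_one_pow_mul_tsum_signedSum_sub (hp : 1 ≤ p) :
    ∑' b : ℕ, (-1) ^ b / (b : ℝ) ^ p * ∑' a : ℕ, signedSum (-1) 1 a / (a * (a - b))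
      = Real.log 2 * (zetaStar (-1) 1 (p + 1) 1 - zetaStar (-1) (-1) (p + 1) 1)
        + zetaStar (-1) (-1) (p + 1) 2
        + (zetaStar (-1) 1 (p + 1) 2 + ∑' n, altLSqTerm (p + 1) n) / 2
        + zetaStar (-1) (-1) (p + 2) 1 := by
  have hp1 : 2 ≤ p + 1 := by omega
  have hc : Subpolynomial (signedSum (-1) 1) := subpolynomial_signedSum (by simp) le_rfl
  have hinner : ∀ b : ℕ, b ≠ 0 → ∑' a : ℕ, signedSum (-1) 1 a / (a * (a - b) : ℝ)
      = (Real.log 2 * (signedSum 1 1 b - signedSum (-1) 1 b) + signedSum (-1) 2 b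
        + (signedSum 1 2 b - signedSum (-1) 1 b ^ 2) / 2 + signedSum (-1) 1 b / b) / b :=
    fun b hb => by
      rw [hc.tsum_div_mul_sub hb, hilbertSum_signedSum_neg_one, signedSum_zero, zero_add]
  rw [tsum_congr fun b => div_pow_mul_of_eq_div hp _ (hinner b), ← sub_neg_eq_add _ (∑' _, _)]
  refine HasSum.tsum_eq (HasSum.congr_fun
    (((((hasSum_zetaStar (by simp) (by simp) hp1 le_rfl).sub
        (hasSum_zetaStar (by simp) (by simp) hp1 le_rfl)).mul_left _).add
      (hasSum_zetaStar (by simp) (by simp) hp1 one_le_two)).add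
      (((hasSum_zetaStar (by simp) (by simp) hp1 one_le_two).sub (hasSum_altLSq hp1)).div_const 2)
      |>.add (hasSum_zetaStar (by simp) (by simp) (by omega) le_rfl)) fun b => ?_)
  ring

theorem tsum_signedSum_mul_tsum_neg_one_pow_sub (hp : 1 ≤ p) :
    ∑' a : ℕ, signedSum (-1) 1 a / (a : ℝ) ^ p * ∑' b : ℕ, (-1) ^ b / (b * (a - b) : ℝ)
      = Real.log 2 * (zetaStar (-1) (-1) (p + 1) 1 - zetaStar 1 (-1) (p + 1) 1)
        - ∑' n, altLSqTerm (p + 1) n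
        - (zetaStar 1 (-1) (p + 2) 1 + zetaStar (-1) (-1) (p + 2) 1) := by
  have hp1 : 2 ≤ p + 1 := by omega
  have hp2 : 2 ≤ p + 2 := by omega
  rw [tsum_congr fun a => div_pow_mul_of_eq_div hp _ (tsum_pow_div_mul_sub_left (by simp)),
    sub_eq_add_neg _ (∑' _, _)]
  refine HasSum.tsum_eq (HasSum.congr_fun
    (((((hasSum_zetaStar (by simp) (by simp) hp1 le_rfl).sub
        (hasSum_zetaStar (by simp) (by simp) hp1 le_rfl)).mul_left _).add (hasSum_altLSq hp1)).sub
      ((hasSum_zetaStar (by simp) (by simp) hp2 le_rfl).add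
        (hasSum_zetaStar (by simp) (by simp) hp2 le_rfl))) fun a => ?_)
  ring

theorem sum_zetaStar_mul_zetaBar (hp : 1 ≤ p) :
    ∑ j ∈ Icc 2 p, zetaStar 1 (-1) j 1 * zetaBar (p + 2 - j)
      = Real.log 2 * (2 * zetaStar (-1) (-1) (p + 1) 1 - zetaStar (-1) 1 (p + 1) 1
          - zetaStar 1 (-1) (p + 1) 1)
        - zetaStar (-1) (-1) (p + 1) 2 - zetaStar (-1) 1 (p + 1) 2 / 2
        - 3 / 2 * ∑' n, altLSqTerm (p + 1) n
        - (p + 1) * zetaStar (-1) (-1) (p + 2) 1 - zetaStar 1 (-1) (p + 2) 1 := by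
  have h := sum_mul_tsum_sub (subpolynomial_signedSum (ε := -1) (by simp) le_rfl)
    (e := fun b => (-1) ^ b) (by simp) hp
  have hdiag : ∑' a : ℕ, signedSum (-1) 1 a * (-1) ^ a / (a : ℝ) ^ (p + 2)
      = zetaStar (-1) (-1) (p + 2) 1 := by
    simpa only [mul_comm] using
      (hasSum_zetaStar (ε₁ := -1) (ε₂ := -1) (by simp) (by simp) (by omega) le_rfl).tsum_eq
  have hterm : ∀ j ∈ Icc 2 p, (∑' a : ℕ, signedSum (-1) 1 a / (a : ℝ) ^ j)
      * ∑' b : ℕ, (-1) ^ b / (b : ℝ) ^ (p + 2 - j)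
      = -(zetaStar 1 (-1) j 1 * zetaBar (p + 2 - j)) := fun j hj => by
    have hj := Finset.mem_Icc.1 hj
    have hstar := hasSum_zetaStar (ε₁ := 1) (ε₂ := -1) (r := 1) (by simp) (by simp) hj.1 le_rfl
    simp only [one_pow, one_mul] at hstar
    rw [hstar.tsum_eq, (hasSum_neg_one_pow_div_pow (by omega)).tsum_eq, mul_neg]
  rw [Finset.sum_congr rfl hterm, Finset.sum_neg_distrib, hdiag,
    tsum_neg_one_pow_mul_tsum_signedSum_sub hp, tsum_signedSum_mul_tsum_neg_one_pow_sub hp] at h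
  linear_combination -h

theorem summable_one_div_pow_mul_tsum_add {c : ℕ → ℝ} (hc : Subpolynomial c) (hp : 1 ≤ p) :
    Summable fun b : ℕ => 1 / (b : ℝ) ^ p * ∑' a : ℕ, c a / (a * (a + b)) := by
  have hinj : Function.Injective fun b : ℕ => -(b : ℤ) := neg_injective.comp Nat.cast_injective
  refine ((summable_div_pow_mul_tsum hc (e := fun _ => (-1) ^ p) (by simp) hinj hp)).congr
    fun b => ?_
  rw [Int.cast_neg, Int.cast_natCast, ← div_pow, neg_div_neg_eq, one_div_pow]
  simp only [sub_neg_eq_add]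

theorem tsum_one_div_mul_tsum_signedSum (hp : 1 ≤ p) :
    ∑' b : ℕ, 1 / (b : ℝ) ^ p * ∑' a : ℕ, (-1) ^ a * signedSum 1 1 a / (a * (a - b))
      + ∑' b : ℕ, 1 / (b : ℝ) ^ p * ∑' a : ℕ, (-1) ^ a * signedSum 1 1 a / (a * (a + b))
      = zetaStar (-1) 1 (p + 1) 2 + zetaStar (-1) (-1) (p + 1) 2 + zetaBar 2 * zetaBar (p + 1)
        + Real.log 2 * (zeta (p + 2) + zetaBar (p + 2))
        + zetaStar (-1) 1 (p + 2) 1 - zetaStar (-1) (-1) (p + 2) 1 := by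
  have hp1 : 2 ≤ p + 1 := by omega
  have hp2 : 2 ≤ p + 2 := by omega
  have hc : Subpolynomial fun a => (-1) ^ a * signedSum 1 1 a :=
    subpolynomial_neg_one_pow.mul (subpolynomial_signedSum (by simp) le_rfl)
  have hinner : ∀ b : ℕ, b ≠ 0 → ∑' a : ℕ, (-1) ^ a * signedSum 1 1 a / (a * (a - b) : ℝ)
      + ∑' a : ℕ, (-1) ^ a * signedSum 1 1 a / (a * (a + b) : ℝ)
      = ((-1) ^ b * (signedSum 1 2 b + signedSum (-1) 2 b - zetaBar 2)
        - ((-1) ^ b * signedSum (-1) 1 b - (1 - (-1) ^ b) * Real.log 2) / b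
        + (-1) ^ b * signedSum 1 1 b / b) / b := fun b hb => by
    rw [hc.tsum_div_mul_sub hb, hc.tsum_div_mul_add hb, signedSum_zero,
      ← tsum_pow_div_mul_add (by simp) hb, ← hilbertSum_sub_hilbertSum_neg]
    ring
  have hsub : Summable fun b : ℕ => 1 / (b : ℝ) ^ p
      * ∑' a : ℕ, (-1) ^ a * signedSum 1 1 a / (a * (a - b)) := by
    simpa only [Int.cast_natCast] using
      summable_div_pow_mul_tsum hc (e := fun _ => 1) (by simp) Nat.cast_injective hp
  rw [← hsub.tsum_add (summable_one_div_pow_mul_tsum_add hc hp)]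
  simp only [← mul_add]
  rw [tsum_congr fun b => div_pow_mul_of_eq_div hp _ (hinner b)]
  refine HasSum.tsum_eq (HasSum.congr_fun
    ((((((hasSum_zetaStar (by simp) (by simp) hp1 one_le_two).add
        (hasSum_zetaStar (by simp) (by simp) hp1 one_le_two)).add
        ((hasSum_zetaBar hp1).mul_left (zetaBar 2))).add
      (((hasSum_one_div_pow hp2).add (hasSum_zetaBar hp2)).mul_left (Real.log 2))).add
      (hasSum_zetaStar (by simp) (by simp) hp2 le_rfl)).sub
      (hasSum_zetaStar (by simp) (by simp) hp2 le_rfl)) fun b => ?_)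
  ring

theorem tsum_signedSum_mul_tsum_one_div_sub (hp : 1 ≤ p) :
    ∑' a : ℕ, (-1) ^ a * signedSum 1 1 a / (a : ℝ) ^ p * ∑' b : ℕ, 1 / (b * (a - b) : ℝ)
      = -∑' n, altHSqTerm (p + 1) n - 2 * zetaStar (-1) 1 (p + 2) 1 := by
  rw [tsum_congr fun a => div_pow_mul_of_eq_div hp _ tsum_one_div_mul_sub]
  refine HasSum.tsum_eq (((hasSum_altHSq (by omega)).sub
    ((hasSum_zetaStar (by simp) (by simp) (by omega) le_rfl).mul_left 2)).congr_fun fun a => ?_)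
  ring

theorem tsum_signedSum_mul_tsum_one_div_add (hp : 1 ≤ p) :
    ∑' a : ℕ, (-1) ^ a * signedSum 1 1 a / (a : ℝ) ^ p * ∑' b : ℕ, 1 / (b * (a + b) : ℝ)
      = -∑' n, altHSqTerm (p + 1) n := by
  rw [tsum_congr fun a => div_pow_mul_of_eq_div hp _ tsum_one_div_mul_add]
  exact HasSum.tsum_eq ((hasSum_altHSq (by omega)).congr_fun fun a => by ring)

theorem sum_zetaStar_mul_zeta (hp : 1 ≤ p) :
    ∑ j ∈ Icc 2 p, (1 + (-1) ^ j) * (zetaStar (-1) 1 j 1 * zeta (p + 2 - j))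
      = Real.log 2 * (zeta (p + 2) + zetaBar (p + 2)) - zetaStar (-1) (-1) (p + 2) 1
        + zeta 2 / 2 * zetaBar (p + 1) + zetaStar (-1) 1 (p + 1) 2 + zetaStar (-1) (-1) (p + 1) 2
        + (p + 2) * zetaStar (-1) 1 (p + 2) 1
        + (1 - (-1) ^ p) * ∑' n, altHSqTerm (p + 1) n := by
  have hstar : ∀ {q : ℕ}, 2 ≤ q → HasSum (fun n : ℕ => (-1) ^ n * signedSum 1 1 n / (n : ℝ) ^ q)
      (zetaStar (-1) 1 q 1) := fun hq => hasSum_zetaStar (by simp) (by simp) hq le_rfl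
  have hc : Subpolynomial fun a => (-1) ^ a * signedSum 1 1 a :=
    subpolynomial_neg_one_pow.mul (subpolynomial_signedSum (by simp) le_rfl)
  have hsub := sum_mul_tsum_sub hc (e := fun _ => 1) (by simp) hp
  have hadd := sum_mul_tsum_add hc (e := fun _ => 1) (by simp) hp
  have hterm : ∀ j ∈ Icc 2 p, (∑' a : ℕ, (-1) ^ a * signedSum 1 1 a / (a : ℝ) ^ j)
      * ∑' b : ℕ, 1 / (b : ℝ) ^ (p + 2 - j) = zetaStar (-1) 1 j 1 * zeta (p + 2 - j) :=
    fun j hj => by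
      have hj := Finset.mem_Icc.1 hj
      rw [(hstar hj.1).tsum_eq, (hasSum_one_div_pow (by omega)).tsum_eq]
  simp only [mul_one] at hsub
  rw [Finset.sum_congr rfl hterm, tsum_signedSum_mul_tsum_one_div_sub hp,
    (hstar (by omega)).tsum_eq] at hsub
  rw [Finset.sum_congr rfl fun j hj => by rw [hterm j hj],
    tsum_signedSum_mul_tsum_one_div_add hp] at hadd
  simp only [add_mul, one_mul, Finset.sum_add_distrib]
  linear_combination hsub + hadd + tsum_one_div_mul_tsum_signedSum hp
    + zetaBar (p + 1) * zetaBar_two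

theorem tsum_one_div_mul_tsum_neg_one_pow_div_add (hp : 1 ≤ p) :
    ∑' b : ℕ, 1 / (b : ℝ) ^ p * ∑' a : ℕ, (-1) ^ a / (a : ℝ) / (a * (a + b))
      = Real.log 2 * (zeta (p + 2) + zetaBar (p + 2)) - zetaBar 2 * zeta (p + 1)
        - zetaStar (-1) (-1) (p + 2) 1 := by
  have hp2 : 2 ≤ p + 2 := by omega
  have hinner : ∀ b : ℕ, b ≠ 0 → ∑' a : ℕ, (-1) ^ a / (a : ℝ) / (a * (a + b))
      = (-zetaBar 2 - ((-1) ^ b * signedSum (-1) 1 b - (1 - (-1) ^ b) * Real.log 2) / b) / b :=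
    fun b hb => by
      rw [subpolynomial_neg_one_pow_div.tsum_div_mul_add hb, hilbertSum_neg_one_pow_div,
        ← tsum_pow_div_mul_add (by simp) hb]
      push_cast
      simp only [div_zero, zero_div, sub_neg_eq_add, zero_sub, neg_add']
      ring
  rw [tsum_congr fun b => div_pow_mul_of_eq_div hp _ (hinner b)]
  refine HasSum.tsum_eq (HasSum.congr_fun
    (((((hasSum_one_div_pow hp2).add (hasSum_zetaBar hp2)).mul_left (Real.log 2)).sub
    ((hasSum_one_div_pow (by omega)).mul_left (zetaBar 2))).sub
    (hasSum_zetaStar (by simp) (by simp) hp2 le_rfl)) fun b => ?_)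
  ring

theorem sum_zetaBar_mul_zeta (hp : 1 ≤ p) :
    ∑ j ∈ Icc 2 p, (-1) ^ j * (zeta (p + 2 - j) * zetaBar (j + 1))
      = zeta 2 / 2 * zeta (p + 1) - Real.log 2 * (zeta (p + 2) + zetaBar (p + 2))
        + zetaStar (-1) (-1) (p + 2) 1 - (-1) ^ p * zetaStar (-1) 1 (p + 2) 1 := by
  have hp2 : 2 ≤ p + 2 := by omega
  have h := sum_mul_tsum_add subpolynomial_neg_one_pow_div (e := fun _ => 1) (by simp) hp
  have hsnd : ∑' a : ℕ, (-1) ^ a / (a : ℝ) / (a : ℝ) ^ p * ∑' b : ℕ, 1 / (b * (a + b) : ℝ)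
      = zetaStar (-1) 1 (p + 2) 1 := by
    rw [tsum_congr fun a => div_pow_mul_of_eq_div hp _ tsum_one_div_mul_add]
    exact HasSum.tsum_eq ((hasSum_zetaStar (by simp) (by simp) hp2 le_rfl).congr_fun
      fun a => by ring)
  have hterm : ∀ j ∈ Icc 2 p, (-1) ^ j * ((∑' a : ℕ, (-1) ^ a / (a : ℝ) / (a : ℝ) ^ j)
      * ∑' b : ℕ, 1 / (b : ℝ) ^ (p + 2 - j))
      = -((-1) ^ j * (zeta (p + 2 - j) * zetaBar (j + 1))) := fun j hj => by
    have hj := Finset.mem_Icc.1 hj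
    simp only [div_div, ← pow_succ']
    rw [(hasSum_neg_one_pow_div_pow (by omega)).tsum_eq, (hasSum_one_div_pow (by omega)).tsum_eq]
    ring
  rw [Finset.sum_congr rfl hterm, Finset.sum_neg_distrib,
    tsum_one_div_mul_tsum_neg_one_pow_div_add hp, hsnd] at h
  linear_combination -h + zeta (p + 1) * zetaBar_two

end Relations

theorem neg_one_pow_pred {R : Type*} [Ring R] {n : ℕ} (hn : n ≠ 0) :
    (-1 : R) ^ (n - 1) = -(-1) ^ n := by
  rw [← pow_sub_one_mul hn, mul_neg_one, neg_neg]

theorem sum_Icc_one_pred {M : Type*} [AddCommMonoid M] (f : ℕ → M) (p : ℕ) :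
    ∑ i ∈ Icc 1 (p - 1), f (i + 1) = ∑ j ∈ Icc 2 p, f j := by
  cases p with
  | zero => rfl
  | succ p => rw [← Finset.map_add_right_Icc 1 p 1, Finset.sum_map]; rfl

theorem sum_sign_mul_zetaStar_mul_zeta (p : ℕ) :
    ∑ j ∈ Icc 2 p, (1 - (-1) ^ (j - 1)) * zetaStar (-1) 1 j 1 * zeta (p + 2 - j)
      = ∑ j ∈ Icc 2 p, (1 + (-1) ^ j) * (zetaStar (-1) 1 j 1 * zeta (p + 2 - j)) :=
  Finset.sum_congr rfl fun j hj => by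
    have hj := (Finset.mem_Icc.1 hj).1
    rw [neg_one_pow_pred (by omega)]
    ring

theorem sum_sign_mul_zeta_mul_zetaBar (p : ℕ) :
    ∑ i ∈ Icc 1 (p - 1), (-1) ^ (i - 1) * zeta (p + 1 - i) * zetaBar (i + 2)
      = ∑ j ∈ Icc 2 p, (-1) ^ j * (zeta (p + 2 - j) * zetaBar (j + 1)) := by
  rw [← sum_Icc_one_pred]
  refine Finset.sum_congr rfl fun i hi => ?_
  have hi := (Finset.mem_Icc.1 hi).1
  rw [neg_one_pow_pred (by omega), Nat.add_sub_add_right (p + 1) 1 i, pow_succ]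
  ring

end EulerSum

open EulerSum in
theorem theorem3p2 (p : ℕ) (hp : 1 ≤ p) :
    -- convergence of the quadratic, alternating zeta and double series
    Summable (altLSqTerm (p + 1)) ∧
    Summable (altHSqTerm (p + 1)) ∧
    (∀ s : ℕ, 1 ≤ s → Summable (zetaBarTerm s) (SummationFilter.conditional ℕ)) ∧
    (∀ ε₁ ∈ ({1, -1} : Set ℝ), ∀ ε₂ ∈ ({1, -1} : Set ℝ), ∀ q r : ℕ, 2 ≤ q → 1 ≤ r →
      Summable (zetaStarTerm ε₁ ε₂ q r)) ∧
    -- the relation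
    3 / 2 * ∑' n : ℕ, altLSqTerm (p + 1) n
        - (1 + (-1 : ℝ) ^ (p - 1)) * ∑' n : ℕ, altHSqTerm (p + 1) n
      = Real.log 2 * (zetaStar (-1) (-1) (p + 1) 1 - zetaStar (-1) 1 (p + 1) 1)
        + 1 / 2 * zeta 2 * (zeta (p + 1) + zetaBar (p + 1))
        + 1 / 2 * zetaStar (-1) 1 (p + 1) 2
        - ∑ j ∈ Finset.Icc 2 p,
            (1 - (-1 : ℝ) ^ (j - 1)) * zetaStar (-1) 1 j 1 * zeta (p + 2 - j)
        - ∑ j ∈ Finset.Icc 2 (p + 1), zetaStar 1 (-1) j 1 * zetaBar (p + 2 - j)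
        + ((p : ℝ) + 2 + (-1 : ℝ) ^ (p - 1)) * zetaStar (-1) 1 (p + 2) 1
        - zetaStar 1 (-1) (p + 2) 1
        - ∑ i ∈ Finset.Icc 1 (p - 1),
            (-1 : ℝ) ^ (i - 1) * zeta (p + 1 - i) * zetaBar (i + 2)
        - ((p : ℝ) + 1) * zetaStar (-1) (-1) (p + 2) 1
        + Real.log 2 * zetaStar (-1) (-1) (p + 1) 1 := by
  have hp1 : 2 ≤ p + 1 := by omega
  refine ⟨summable_altLSqTerm hp1, summable_altHSqTerm hp1, fun s hs => summable_zetaBarTerm hs,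
    fun ε₁ h₁ ε₂ h₂ q r hq hr =>
      summable_zetaStarTerm (abs_le_one_of_mem h₁) (abs_le_one_of_mem h₂) hq hr, ?_⟩
  rw [sum_sign_mul_zetaStar_mul_zeta, sum_zetaStar_mul_zeta hp, sum_sign_mul_zeta_mul_zetaBar,
    sum_zetaBar_mul_zeta hp, Finset.sum_Icc_succ_top (by omega), sum_zetaStar_mul_zetaBar hp,
    show p + 2 - (p + 1) = 1 by omega, zetaBar_one, neg_one_pow_pred (by omega)]
  ring
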